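/- **Setting.** Let $\mathbf A\in\mathbb R^{s\times s}$, $\mathbf b\in\mathbb R^s$ ($s\ge1$) be the coefficients of a Runge–Kutta method, let $r(z)=1+z\,\mathbf b^T(I-z\mathbf A)^{-1}\mathbb 1$ with $\mathbb 1=(1,\dots,1)^T$, $\mathbf q(z)=\mathbf b^T(I-z\mathbf A)^{-1}$, and assume: $|r(z)|\le1$ for $\operatorname{Re}z\le0$; the order is at least one ($\sum_i b_i=1$); $|r(iy)|<1$ for real $y\ne0$; $\mathbf A$ is invertible; and $\mathbf b^T\mathbf A^{-1}=(0,\dots,0,1)$. Let $\mathbf e_n(z)$ be the last row of $\mathbf E_n(z)$, where $$\Big(\big(\mathbf A+\tfrac{\zeta}{1-\zeta}\mathbb 1\mathbf b^T\big)^{-1}-zI\Big)^{-1}=\sum_{n\ge0}\mathbf E_n(z)\,\zeta^n .$$ Fix a norm $\|\cdot\|$ on $\mathbb C^s$ and constants $\nu>1$, $b>0$, $C_{\mathbf q}>0$ such that $I-z\mathbf A$ is invertible and $\|\mathbf q(z)\|\le C_{\mathbf q}$ for $\operatorname{Re}z\le b$, and $|r(z)|\le e^{\nu\operatorname{Re}z}$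 for $0\le\operatorname{Re}z\le b$. Let $h,L_0>0$, $x\in\mathbb R$, $d=|x|$, $n\ge0$ and $Q\ge1$ integers, $t_n=nh$. Let $K(z,x)=\frac{1}{2\sqrt{z/i}}e^{-|x|\sqrt{z/i}}$ with $\sqrt{z/i}=e^{-i\pi/4}\sqrt z$ (branch of $\sqrt z$ with positive real part, cut along $(-\infty,0]$), let $G(\lambda,x)=K(\lambda e^{-i\pi},x)-K(\lambda e^{i\pi},x)$, where for $\lambda>0$ the two terms are the boundary values of $K$ on the lower and the upper side of the cut, and $$\mathbf I_{n,0}=\frac{h}{2\pi i}\int_0^{L_0}G(\lambda,x)\,\mathbf e_n(-h\lambda)\,d\lambda=\int_{-1}^1(1+y)^{-1/2}\mathbf g(y)\,dy,$$ $$\mathbf g(y)=\frac{hL_0}{4\pi i}\sqrt{1+y}\;G\big(\tfrac{(1+y)L_0}2,x\big)\,\mathbf e_n\big(-\tfrac{h(1+y)L_0}2\big).$$ Let $\boldsymbol\tau_{n,0}(Q)=\mathbf I_{n,0}-\sum_{j=1}^Q w_j\,\mathbf g(y_j)$ be the error of the $Q$-node Gauss–Jacobi rule with weight $(1+y)^{-1/2}$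 on $[-1,1]$ (distinct nodes $y_j\in(-1,1)$, exact for polynomials of degree at most $2Q-1$). Put $D=d\sqrt{3L_0/2}+\nu t_nL_0/2$, $$\varrho_{\max}=1+\frac{2b}{L_0h}+\sqrt{\Big(\frac{2b}{L_0h}\Big)^2+\frac{4b}{L_0h}},\qquad \varrho_{opt}=\frac{2Q}{D}+\sqrt{1+\Big(\frac{2Q}{D}\Big)^2}$$ ($\varrho_{opt}=+\infty$ if $D=0$), and assume $\varrho_{\max}\ge2+\sqrt3$. **Theorem.** If $\varrho_{opt}\in(2+\sqrt3,\varrho_{\max})$, then $$\|\boldsymbol\tau_{n,0}(Q)\|\le C_{\mathbf q}\,h\,\frac{4\sqrt{L_0}}{\pi}\,\frac{\varrho_{opt}}{\varrho_{opt}-1}\left(\frac{e\,\big(d\sqrt{3L_0/2}+\nu t_nL_0/2\big)}{4Q}\right)^{2Q}.$$ Otherwise $$\|\boldsymbol\tau_{n,0}(Q)\|\le C_{\mathbf q}\,h\,\frac{4\sqrt{L_0}}{\pi}\,\frac{\varrho_{\max}^{-2Q+1}}{\varrho_{\max}-1}\,\exp\!\left(\frac bh\Big(d\sqrt{6/L_0}+\nu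 t_n\Big)\right).$$ -/

import Mathlib

open MeasureTheory Matrix

noncomputable section

namespace SchrodingerCQ

/-! ### Runge-Kutta methods

A method has `s + 1` stages and is given by the real Butcher coefficients `A` and `b`. -/

/-- The coefficient matrix viewed as a complex matrix. -/
def complexMatrix {s : ℕ} (A : Matrix (Fin (s + 1)) (Fin (s + 1)) ℝ) :
    Matrix (Fin (s + 1)) (Fin (s + 1)) ℂ :=
  A.map (fun a => (a : ℂ))

/-- The weight vector viewed as a complex vector. -/
def complexVector {s : ℕ} (b : Fin (s + 1) → ℝ) : Fin (s + 1) → ℂ :=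
  fun i => (b i : ℂ)

/-- The row vector `q(z) = bᵀ (I - z A)⁻¹`. -/
def qVector {s : ℕ} (A : Matrix (Fin (s + 1)) (Fin (s + 1)) ℝ) (b : Fin (s + 1) → ℝ) (z : ℂ) :
    Fin (s + 1) → ℂ :=
  complexVector b ᵥ* (1 - z • complexMatrix A)⁻¹

/-- The stability function `r(z) = 1 + z bᵀ (I - z A)⁻¹ 𝟙`. -/
def stabilityFunction {s : ℕ} (A : Matrix (Fin (s + 1)) (Fin (s + 1)) ℝ)
    (b : Fin (s + 1) → ℝ) (z : ℂ) : ℂ :=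
  1 + z * (complexVector b ⬝ᵥ ((1 - z • complexMatrix A)⁻¹ *ᵥ (1 : Fin (s + 1) → ℂ)))

/-- The standing assumptions on the Runge-Kutta method. -/
structure RungeKuttaAssumption {s : ℕ} (A : Matrix (Fin (s + 1)) (Fin (s + 1)) ℝ)
    (b : Fin (s + 1) → ℝ) : Prop where
  /-- A-stability -/
  aStable : ∀ z : ℂ, z.re ≤ 0 → ‖stabilityFunction A b z‖ ≤ 1
  /-- classical order at least one -/
  order_one : ∑ i, b i = 1
  /-- strict bound on the punctured imaginary axis -/
  strict : ∀ y : ℝ, y ≠ 0 → ‖stabilityFunction A b (Complex.I * y)‖ < 1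
  /-- the coefficient matrix is invertible -/
  invertible : IsUnit A
  /-- stiff accuracy, `bᵀ A⁻¹ = (0, …, 0, 1)` -/
  stifflyAccurate : b ᵥ* A⁻¹ = Pi.single (Fin.last s) 1

/-- The symbol `Δ(ζ) = (A + ζ / (1 - ζ) 𝟙 bᵀ)⁻¹`, as a matrix of power series in `ζ`. -/
def symbol {s : ℕ} (A : Matrix (Fin (s + 1)) (Fin (s + 1)) ℝ) (b : Fin (s + 1) → ℝ) :
    Matrix (Fin (s + 1)) (Fin (s + 1)) (PowerSeries ℂ) :=
  ((complexMatrix A).map (fun a => PowerSeries.C a)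
    + ((PowerSeries.X : PowerSeries ℂ) * (1 - PowerSeries.X)⁻¹) •
      (vecMulVec (1 : Fin (s + 1) → ℂ) (complexVector b)).map (fun a => PowerSeries.C a))⁻¹

/-- The matrices `E_n(z)` given by `(Δ(ζ) - z I)⁻¹ = ∑ₙ E_n(z) ζⁿ`. -/
def EMatrix {s : ℕ} (A : Matrix (Fin (s + 1)) (Fin (s + 1)) ℝ) (b : Fin (s + 1) → ℝ)
    (n : ℕ) (z : ℂ) : Matrix (Fin (s + 1)) (Fin (s + 1)) ℂ :=
  ((symbol A b - (PowerSeries.C z : PowerSeries ℂ) • 1)⁻¹).map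
    (fun p => PowerSeries.coeff n p)

/-- The row vector `e_n(z)`, the last row of `E_n(z)`. -/
def eVector {s : ℕ} (A : Matrix (Fin (s + 1)) (Fin (s + 1)) ℝ) (b : Fin (s + 1) → ℝ)
    (n : ℕ) (z : ℂ) : Fin (s + 1) → ℂ :=
  fun j => EMatrix A b n z (Fin.last s) j

/-- `ν > 1`, `β > 0`, `Cq > 0` are constants for which
`|r(z)| ≤ exp (ν Re z)` for `0 ≤ Re z ≤ β` and `‖q(z)‖ ≤ Cq` for `Re z ≤ β`, the inverse in the
definitions of `r` and `q` being a genuine inverse on the half-plane `Re z ≤ β`.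
`N` is the norm on row vectors that is used. -/
structure IsBoundConstants {s : ℕ} (A : Matrix (Fin (s + 1)) (Fin (s + 1)) ℝ)
    (b : Fin (s + 1) → ℝ) (N : Seminorm ℂ (Fin (s + 1) → ℂ)) (ν β Cq : ℝ) : Prop where
  one_lt_nu : 1 < ν
  beta_pos : 0 < β
  Cq_pos : 0 < Cq
  defined : ∀ z : ℂ, z.re ≤ β → IsUnit (1 - z • complexMatrix A)
  r_bound : ∀ z : ℂ, 0 ≤ z.re → z.re ≤ β → ‖stabilityFunction A b z‖ ≤ Real.exp (ν * z.re)
  q_bound : ∀ z : ℂ, z.re ≤ β → N (qVector A b z) ≤ Cq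

/-! ### The one-dimensional Schrödinger transfer function -/

/-- The one-dimensional transfer function `K(z, x) = exp (-|x| √(z/i)) / (2 √(z/i))`, with
`√(z/i) = e^{-iπ/4} √z`, at the point `z = lam e^{iθ}`, `lam > 0`, `-π ≤ θ ≤ π`, where
`√z = √lam e^{iθ/2}` is the principal square root for `-π < θ < π` and, for `θ = ±π`,
its boundary value on the corresponding side of the cut. -/
def transferK (lam θ x : ℝ) : ℂ :=
  let sqrtz : ℂ := (Real.sqrt lam : ℂ) * Complex.exp (Complex.I * θ / 2)
  let σ : ℂ := Complex.exp (-(Complex.I * Real.pi / 4)) * sqrtz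
  1 / (2 * σ) * Complex.exp (-((|x| : ℝ) : ℂ) * σ)

/-- The jump `G(lam, x) = K(lam e^{-iπ}, x) - K(lam e^{iπ}, x)` across the cut. -/
def jumpG (lam x : ℝ) : ℂ :=
  transferK lam (-Real.pi) x - transferK lam Real.pi x

/-- `I_{n,0} = h / (2πi) ∫_0^{L₀} G(lam, x) e_n(-h lam) dlam`. -/
def initialIntegral {s : ℕ} (A : Matrix (Fin (s + 1)) (Fin (s + 1)) ℝ) (b : Fin (s + 1) → ℝ)
    (h L₀ x : ℝ) (n : ℕ) : Fin (s + 1) → ℂ :=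
  ((h : ℂ) / (2 * Real.pi * Complex.I)) •
    ∫ lam in (0 : ℝ)..L₀, jumpG lam x • eVector A b n (-(h : ℂ) * lam)

/-! ### Gauss quadrature -/

/-- `Q` distinct nodes in `(-1, 1)` with real weights form the `Q`-node Gauss rule for the weight
function `w` on `[-1, 1]`: the rule is exact for all polynomials of degree at most `2Q - 1`. -/
structure IsGaussRule (w : ℝ → ℝ) (Q : ℕ) (node weight : Fin Q → ℝ) : Prop where
  injective : Function.Injective node
  mem_Ioo : ∀ j, node j ∈ Set.Ioo (-1 : ℝ) 1
  exact : ∀ p : Polynomial ℝ, p.natDegree < 2 * Q →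
    ∑ j, weight j * p.eval (node j) = ∫ y in (-1 : ℝ)..1, w y * p.eval y

/-- The Jacobi weight `(1 + y)^{-1/2}`. -/
def jacobiWeight (y : ℝ) : ℝ := (1 + y) ^ (-(1 / 2) : ℝ)

/-- After the substitution `lam = (1 + y) L₀ / 2`, the integral `I_{n,0}` is
`∫_{-1}^1 (1 + y)^{-1/2} g(y) dy`; this is the function `g`, that is, the transformed
integrand divided by the Jacobi weight. -/
def smoothFactor {s : ℕ} (A : Matrix (Fin (s + 1)) (Fin (s + 1)) ℝ) (b : Fin (s + 1) → ℝ)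
    (h L₀ x : ℝ) (n : ℕ) (y : ℝ) : Fin (s + 1) → ℂ :=
  ((h : ℂ) * L₀ / (4 * Real.pi * Complex.I) * (Real.sqrt (1 + y) : ℂ)
      * jumpG ((1 + y) * L₀ / 2) x) •
    eVector A b n (-(h : ℂ) * ((1 + y) * L₀ / 2))

/-- The error `τ_{n,0}(Q)` of the quadrature rule applied to `I_{n,0}`. -/
def quadratureError {s : ℕ} (A : Matrix (Fin (s + 1)) (Fin (s + 1)) ℝ) (b : Fin (s + 1) → ℝ)
    (h L₀ x : ℝ) (n : ℕ) {Q : ℕ} (node weight : Fin Q → ℝ) : Fin (s + 1) → ℂ :=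
  initialIntegral A b h L₀ x n
    - ∑ j, (weight j : ℂ) • smoothFactor A b h L₀ x n (node j)

/-! ### The parameters of the bound -/

/-- `ρ_max = 1 + 2β/(L₀h) + √((2β/(L₀h))² + 4β/(L₀h))`. -/
def rhoMax (β L₀ h : ℝ) : ℝ :=
  1 + 2 * β / (L₀ * h) + Real.sqrt ((2 * β / (L₀ * h)) ^ 2 + 4 * β / (L₀ * h))

/-- `d √(3L₀/2) + ν t L₀/2`. -/
def growth (d ν t L₀ : ℝ) : ℝ :=
  d * Real.sqrt (3 * L₀ / 2) + ν * t * L₀ / 2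

/-- `ρ_opt = 2Q/D + √(1 + (2Q/D)²)` with `D = d √(3L₀/2) + ν t L₀/2`. -/
def rhoOpt (d ν t L₀ : ℝ) (Q : ℕ) : ℝ :=
  2 * Q / growth d ν t L₀ + Real.sqrt (1 + (2 * Q / growth d ν t L₀) ^ 2)

end SchrodingerCQ

end

/-! After the substitution `λ = (1 + y) L₀ / 2` the integrand is the Jacobi weight times a function
that extends holomorphically to complex `y`: the jump `G(λ, x)` is `cosh √(i x² λ)` up to a constant
multiple of `λ^{-1/2}`, and `cosh √u` is entire, while comparing generating functions gives
`e_n(z) = r(z)^n q(z)`. On the Bernstein ellipse `E_ρ` with semi-major axis `a = (ρ + ρ⁻¹) / 2 ≥ 2`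
the extension is bounded by a constant times `exp (D (a - 1))` as long as `Re (-h λ) ≤ β` there,
that is, as long as `ρ ≤ ρ_max`. A Gauss rule has nonnegative weights and is exact up to degree
`2Q - 1`, so its error is controlled by the remainder of the Chebyshev expansion, which is
`O(ρ^{-2Q})`. The resulting bound `ρ^{-2Q} exp (D (a - 1))` has its stationary point in `ρ` where
`D (ρ - ρ⁻¹) = 4Q`, which is `ρ_opt`; the other choice is `ρ = ρ_max`. -/

namespace SchrodingerCQ

open Complex (I)

variable {E : Type*} [NormedAddCommGroup E] [NormedSpace ℂ E]

section BernsteinEllipse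

/-- The Joukowski map, which carries the circles `‖z‖ = ρ` and `‖z‖ = ρ⁻¹` to the ellipse with foci
`±1` whose semi-axes sum to `ρ`. -/
noncomputable def joukowski (z : ℂ) : ℂ := (z + z⁻¹) / 2

/-- The closed Bernstein ellipse (boundary and interior) of parameter `ρ ≥ 1`, on which the
integrands are required to be holomorphic. It is encoded as the image of an annulus, so that
Laurent series on the annulus become Chebyshev series on the ellipse. -/
def bernsteinEllipse (ρ : ℝ) : Set ℂ := joukowski '' {z | 1 ≤ ‖z‖ ∧ ‖z‖ ≤ ρ}

/-- The semi-major axis of `bernsteinEllipse ρ`. -/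
noncomputable def semiMajorAxis (ρ : ℝ) : ℝ := (ρ + ρ⁻¹) / 2

lemma joukowski_inv (z : ℂ) : joukowski z⁻¹ = joukowski z := by
  rw [joukowski, inv_inv, add_comm, joukowski]

lemma differentiableAt_joukowski {z : ℂ} (hz : z ≠ 0) : DifferentiableAt ℂ joukowski z :=
  (differentiableAt_id.add (differentiableAt_inv hz)).div_const 2

lemma joukowski_exp_mul_I (θ : ℂ) : joukowski (Complex.exp (θ * I)) = Complex.cos θ := by
  rw [joukowski, ← Complex.exp_neg, ← neg_mul, Complex.cos]

lemma monotoneOn_semiMajorAxis : MonotoneOn semiMajorAxis (Set.Ici 1) := by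
  intro x hx y hy hxy
  rw [Set.mem_Ici] at hx hy
  have hdiff : semiMajorAxis y - semiMajorAxis x = (y - x) * (x * y - 1) / (2 * (x * y)) := by
    unfold semiMajorAxis
    field_simp
    ring
  have : 0 ≤ (y - x) * (x * y - 1) / (2 * (x * y)) :=
    div_nonneg (mul_nonneg (by linarith) (by nlinarith)) (by positivity)
  linarith

lemma norm_le_semiMajorAxis {u : ℂ} {ρ : ℝ} (hu : u ∈ bernsteinEllipse ρ) :
    ‖u‖ ≤ semiMajorAxis ρ := by
  obtain ⟨z, ⟨h1, hρ⟩, rfl⟩ := hu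
  calc ‖joukowski z‖ ≤ semiMajorAxis ‖z‖ := by
        rw [joukowski, semiMajorAxis, norm_div, Complex.norm_ofNat, ← norm_inv]
        gcongr
        exact norm_add_le _ _
    _ ≤ semiMajorAxis ρ := monotoneOn_semiMajorAxis h1 (h1.trans hρ) hρ

lemma ofReal_mem_bernsteinEllipse {ρ y : ℝ} (hρ : 1 ≤ ρ) (hy : y ∈ Set.Icc (-1) 1) :
    (y : ℂ) ∈ bernsteinEllipse ρ := by
  refine ⟨Complex.exp (Real.arccos y * I), ?_, ?_⟩
  · simpa only [Set.mem_ofPred_eq, Complex.norm_exp_ofReal_mul_I, le_refl, true_and]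
  · rw [joukowski_exp_mul_I, ← Complex.ofReal_cos, Real.cos_arccos hy.1 hy.2]

end BernsteinEllipse

section ChebyshevSeries

open Polynomial (Chebyshev.T)

lemma fact_two_pi_pos : Fact (0 < 2 * Real.pi) := ⟨Real.two_pi_pos⟩

attribute [local instance] fact_two_pi_pos

lemma coe_toCircle_coe (θ : ℝ) :
    (AddCircle.toCircle (θ : AddCircle (2 * Real.pi)) : ℂ) = Complex.exp (θ * I) := by
  rw [AddCircle.toCircle_apply_mk, div_self Real.two_pi_pos.ne', one_mul, Circle.coe_exp]

lemma fourier_coe_eq_exp (n : ℤ) (θ : ℝ) :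
    fourier n (θ : AddCircle (2 * Real.pi)) = Complex.exp (n * θ * I) := by
  rw [fourier_apply, AddCircle.toCircle_zsmul, Circle.coe_zpow, coe_toCircle_coe,
    ← Complex.exp_int_mul, mul_assoc]

lemma fourierCoeff_toCircle_eq_circleIntegral (F : ℂ → E) (k : ℕ) :
    fourierCoeff (fun x : AddCircle (2 * Real.pi) => F x.toCircle) k =
      (2 * Real.pi * I : ℂ)⁻¹ • ∮ z in C(0, 1), (z ^ (k + 1))⁻¹ • F z := by
  have hintegrand (θ : ℝ) : deriv (circleMap 0 1) θ •
      (circleMap 0 1 θ ^ (k + 1))⁻¹ • F (circleMap 0 1 θ) =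
        I • (fourier (-(k : ℤ)) (θ : AddCircle (2 * Real.pi)) • F (Complex.exp (θ * I))) := by
    rw [deriv_circleMap, circleMap_zero, Complex.ofReal_one, one_mul, fourier_coe_eq_exp,
      smul_smul, smul_smul, ← Complex.exp_nat_mul, ← Complex.exp_neg, mul_comm _ I, mul_assoc,
      ← Complex.exp_add]
    push_cast
    ring_nf
  rw [fourierCoeff_eq_intervalIntegral _ _ 0, circleIntegral, zero_add]
  simp only [hintegrand, coe_toCircle_coe]
  rw [intervalIntegral.integral_smul, smul_smul, mul_inv, inv_mul_cancel_right₀ Complex.I_ne_zero,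
    ← Complex.coe_smul]
  push_cast
  rw [one_div]

lemma fourierCoeff_neg_of_even {T : ℝ} [Fact (0 < T)] {g : AddCircle T → E}
    (hg : ∀ x, g (-x) = g x) (k : ℤ) : fourierCoeff g (-k) = fourierCoeff g k := by
  rw [fourierCoeff, ← integral_neg_eq_self, fourierCoeff]
  simp only [hg, fourier_apply, smul_neg, neg_smul, neg_neg]

/-- The circle of integration is moved from `‖z‖ = 1` to `‖z‖ = ρ`. -/
lemma norm_fourierCoeff_toCircle_le [CompleteSpace E] {F : ℂ → E} {ρ M : ℝ} (hρ : 1 ≤ ρ)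
    (hF : ∀ z : ℂ, 1 ≤ ‖z‖ → ‖z‖ ≤ ρ → DifferentiableAt ℂ F z)
    (hM : ∀ z : ℂ, ‖z‖ = ρ → ‖F z‖ ≤ M) (k : ℕ) :
    ‖fourierCoeff (fun x : AddCircle (2 * Real.pi) => F x.toCircle) k‖ ≤ M * ρ⁻¹ ^ k := by
  have hρ0 : 0 < ρ := by linarith
  have hdiff (z : ℂ) (h1 : 1 ≤ ‖z‖) (hz : ‖z‖ ≤ ρ) :
      DifferentiableAt ℂ (fun z => (z ^ (k + 1))⁻¹ • F z) z := by
    have hz0 : z ≠ 0 := norm_pos_iff.1 (by linarith)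
    exact ((differentiableAt_id.pow (k + 1)).inv (pow_ne_zero _ hz0)).smul (hF z h1 hz)
  have hcircle : ∮ z in C(0, 1), (z ^ (k + 1))⁻¹ • F z = ∮ z in C(0, ρ), (z ^ (k + 1))⁻¹ • F z := by
    refine (Complex.circleIntegral_eq_of_differentiable_on_annulus_off_countable one_pos hρ
      Set.countable_empty (fun z hz => ?_) fun z hz => ?_).symm
    · simp only [Set.mem_sdiff, mem_closedBall_zero_iff, mem_ball_zero_iff, not_lt] at hz
      exact (hdiff z hz.2 hz.1).continuousAt.continuousWithinAt
    · simp only [Set.mem_sdiff, mem_closedBall_zero_iff, mem_ball_zero_iff, not_le] at hz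
      exact hdiff z hz.1.2.le hz.1.1.le
  have hbound (z : ℂ) (hz : z ∈ Metric.sphere (0 : ℂ) ρ) :
      ‖(z ^ (k + 1))⁻¹ • F z‖ ≤ (ρ ^ (k + 1))⁻¹ * M := by
    rw [mem_sphere_zero_iff_norm] at hz
    rw [norm_smul, norm_inv, norm_pow, hz]
    gcongr
    exact hM z hz
  rw [fourierCoeff_toCircle_eq_circleIntegral, hcircle]
  refine (circleIntegral.norm_two_pi_i_inv_smul_integral_le_of_norm_le_const hρ0.le
    hbound).trans_eq ?_
  rw [inv_pow, pow_succ]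
  field_simp

lemma hasSum_cos_of_even {g : C(AddCircle (2 * Real.pi), ℂ)} (hg : ∀ x, g (-x) = g x)
    (hsum : Summable fun k : ℕ => fourierCoeff g k) (θ : ℝ) :
    HasSum (fun k : ℕ => (if k = 0 then fourierCoeff g 0 else 2 * fourierCoeff g k) *
      Complex.cos (k * θ)) (g θ) := by
  have hneg := fourierCoeff_neg_of_even hg
  have hsum' : Summable (fourierCoeff g) := .of_nat_of_neg hsum (by simpa only [hneg] using hsum)
  have hseries := (has_pointwise_sum_fourier_series_of_summable hsum' θ).nat_add_neg.sub
    (hasSum_ite_eq 0 (fourierCoeff g 0))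
  have hzero : fourierCoeff g 0 • fourier 0 (θ : AddCircle (2 * Real.pi)) = fourierCoeff g 0 := by
    rw [fourier_zero, smul_eq_mul, mul_one]
  rw [hzero, add_sub_cancel_right] at hseries
  refine hseries.congr_fun fun k => ?_
  simp only [hneg, fourier_coe_eq_exp, smul_eq_mul]
  rcases eq_or_ne k 0 with rfl | hk
  · simp
  · rw [if_neg hk, if_neg hk, Complex.cos]
    push_cast
    ring_nf

variable {f : ℂ → ℂ} {ρ M : ℝ}

lemma exists_hasSum_chebyshev (hρ : 1 < ρ)
    (hf : ∀ u ∈ bernsteinEllipse ρ, DifferentiableAt ℂ f u)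
    (hM : ∀ u ∈ bernsteinEllipse ρ, ‖f u‖ ≤ M) :
    ∃ c : ℕ → ℂ, (∀ k, ‖c k‖ ≤ 2 * M * ρ⁻¹ ^ k) ∧ ∀ y ∈ Set.Icc (-1 : ℝ) 1,
      HasSum (fun k : ℕ => c k * (Chebyshev.T ℂ k).eval (y : ℂ)) (f y) := by
  have hF (z : ℂ) (h1 : 1 ≤ ‖z‖) (hz : ‖z‖ ≤ ρ) :
      DifferentiableAt ℂ (fun z => f (joukowski z)) z :=
    (hf _ ⟨z, ⟨h1, hz⟩, rfl⟩).comp z (differentiableAt_joukowski (norm_pos_iff.1 (by linarith)))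
  let g : C(AddCircle (2 * Real.pi), ℂ) :=
    ⟨fun x => f (joukowski x.toCircle), continuous_iff_continuousAt.2 fun x =>
      ContinuousAt.comp (f := fun x : AddCircle (2 * Real.pi) => (x.toCircle : ℂ))
        (hF _ (Circle.norm_coe _).ge ((Circle.norm_coe _).trans_le hρ.le)).continuousAt
        (continuous_subtype_val.comp AddCircle.continuous_toCircle).continuousAt⟩
  have hg (x) : g (-x) = g x := by
    simp only [g, ContinuousMap.coe_mk, AddCircle.toCircle_neg, Circle.coe_inv, joukowski_inv]
  have hdecay (k : ℕ) : ‖fourierCoeff g k‖ ≤ M * ρ⁻¹ ^ k :=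
    norm_fourierCoeff_toCircle_le hρ.le hF
      (fun z hz => hM _ ⟨z, ⟨hρ.le.trans hz.ge, hz.le⟩, rfl⟩) k
  have hsum : Summable fun k : ℕ => fourierCoeff g k :=
    .of_norm_bounded ((summable_geometric_of_lt_one (by positivity)
      (inv_lt_one_of_one_lt₀ hρ)).mul_left M) hdecay
  refine ⟨fun k => if k = 0 then fourierCoeff g 0 else 2 * fourierCoeff g k, fun k => ?_,
    fun y hy => ?_⟩
  · dsimp only
    split_ifs with hk
    · have h0 := hdecay 0
      subst hk
      rw [Nat.cast_zero] at h0
      linarith [norm_nonneg (fourierCoeff g 0)]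
    · rw [norm_mul, Complex.norm_ofNat, mul_assoc]
      gcongr
      exact hdecay k
  · have hy' : (y : ℂ) = Complex.cos (Real.arccos y) := by
      rw [← Complex.ofReal_cos, Real.cos_arccos hy.1 hy.2]
    have hgy : g (Real.arccos y : ℝ) = f y := by
      rw [hy', ← joukowski_exp_mul_I, ← coe_toCircle_coe]
      rfl
    rw [← hgy]
    refine (hasSum_cos_of_even hg hsum _).congr_fun fun k => ?_
    rw [hy', Polynomial.Chebyshev.T_complex_cos, Int.cast_natCast]

lemma exists_polynomial_approximation (hρ : 1 < ρ)
    (hf : ∀ u ∈ bernsteinEllipse ρ, DifferentiableAt ℂ f u)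
    (hM : ∀ u ∈ bernsteinEllipse ρ, ‖f u‖ ≤ M) {m : ℕ} (hm : 0 < m) :
    ∃ p : Polynomial ℂ, p.natDegree < m ∧ ∀ y ∈ Set.Icc (-1 : ℝ) 1,
      ‖f y - p.eval (y : ℂ)‖ ≤ 2 * M * ρ⁻¹ ^ m / (1 - ρ⁻¹) := by
  obtain ⟨c, hc, hsum⟩ := exists_hasSum_chebyshev hρ hf hM
  refine ⟨∑ k ∈ Finset.range m, Polynomial.C (c k) * Chebyshev.T ℂ k, ?_, fun y hy => ?_⟩
  · refine Nat.lt_of_le_pred hm (Polynomial.natDegree_sum_le_of_forall_le _ _ fun k hk => ?_)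
    refine (Polynomial.natDegree_C_mul_le _ _).trans ?_
    rw [Polynomial.Chebyshev.natDegree_T, Int.natAbs_natCast]
    exact Nat.le_pred_of_lt (Finset.mem_range.1 hk)
  · have hterm (k : ℕ) : ‖c k * (Chebyshev.T ℂ k).eval (y : ℂ)‖ ≤ 2 * M * ρ⁻¹ ^ k := by
      rw [← Polynomial.Chebyshev.complex_ofReal_eval_T, norm_mul, Complex.norm_real]
      exact (mul_le_of_le_one_right (norm_nonneg _)
        (Polynomial.Chebyshev.abs_eval_T_real_le_one k (abs_le.2 hy))).trans (hc k)
    have htail := norm_sub_le_of_geometric_bound_of_hasSum (inv_lt_one_of_one_lt₀ hρ) hterm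
      (hsum y hy) m
    simpa only [Polynomial.eval_finsetSum, Polynomial.eval_mul, Polynomial.eval_C,
      norm_sub_rev] using htail

end ChebyshevSeries

section SeminormDuality

variable {𝕜 F : Type*} [RCLike 𝕜] [NormedAddCommGroup F] [NormedSpace 𝕜 F]

lemma exists_dual_eq_seminorm {p : Seminorm 𝕜 F} (hp : Continuous p) (v : F) :
    ∃ φ : StrongDual 𝕜 F, (∀ w, ‖φ w‖ ≤ p w) ∧ ‖φ v‖ = p v := by
  rcases eq_or_ne v 0 with rfl | hv
  · exact ⟨0, fun w => by simp, by simp⟩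
  let coord : ↥(𝕜 ∙ v) →ₗ[𝕜] 𝕜 := LinearEquiv.coord 𝕜 F v hv
  have hcoord (u : 𝕜 ∙ v) : ‖((p v : 𝕜) • coord) u‖ ≤ p u := by
    have hu : p u = ‖coord u‖ * p v := by
      rw [← map_smul_eq_mul, ← LinearEquiv.coord_apply_smul 𝕜 F v hv u]
      rfl
    rw [LinearMap.smul_apply, norm_smul, RCLike.norm_ofReal, abs_of_nonneg (apply_nonneg p v), hu,
      mul_comm]
  obtain ⟨φ, hφ, hle⟩ :=
    Module.Dual.exists_continuous_extension_of_le_seminorm (𝕜 ∙ v) _ hp hcoord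
  refine ⟨φ, hle, ?_⟩
  have hself : coord ⟨v, Submodule.mem_span_singleton_self v⟩ = 1 :=
    LinearEquiv.coord_self 𝕜 F v hv
  rw [hφ ⟨v, Submodule.mem_span_singleton_self v⟩, LinearMap.smul_apply, hself, smul_eq_mul,
    mul_one, RCLike.norm_ofReal, abs_of_nonneg (apply_nonneg p v)]

end SeminormDuality

namespace IsGaussRule

variable {w : ℝ → ℝ} {Q : ℕ} {node weight : Fin Q → ℝ}

lemma weight_nonneg (hG : IsGaussRule w Q node weight)
    (hw : ∀ y ∈ Set.Icc (-1 : ℝ) 1, 0 ≤ w y) (j : Fin Q) : 0 ≤ weight j := by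
  classical
  let ℓ : Polynomial ℝ := ∏ k ∈ Finset.univ.erase j, (Polynomial.X - Polynomial.C (node k))
  have hℓ (y : ℝ) : ℓ.eval y = ∏ k ∈ Finset.univ.erase j, (y - node k) := by
    simp only [ℓ, Polynomial.eval_prod, Polynomial.eval_sub, Polynomial.eval_X, Polynomial.eval_C]
  have hdeg : (ℓ ^ 2).natDegree < 2 * Q := by
    rw [Polynomial.natDegree_pow,
      Polynomial.natDegree_prod_of_monic _ _ fun k _ => Polynomial.monic_X_sub_C _]
    simp only [Polynomial.natDegree_X_sub_C, Finset.sum_const, Finset.card_erase_of_mem,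
      Finset.mem_univ, Finset.card_univ, Fintype.card_fin, smul_eq_mul, mul_one]
    have := j.pos
    omega
  have hexact : weight j * ℓ.eval (node j) ^ 2 = ∫ y in (-1 : ℝ)..1, w y * ℓ.eval y ^ 2 := by
    have hvanish (k : Fin Q) (hk : k ≠ j) : ℓ.eval (node k) = 0 := by
      rw [hℓ]
      exact Finset.prod_eq_zero (Finset.mem_erase.2 ⟨hk, Finset.mem_univ k⟩) (sub_self _)
    have h := hG.exact (ℓ ^ 2) hdeg
    simp only [Polynomial.eval_pow] at h
    rwa [Fintype.sum_eq_single j fun k hk => by rw [hvanish k hk]; ring] at h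
  have hne : ℓ.eval (node j) ≠ 0 := by
    rw [hℓ]
    exact Finset.prod_ne_zero_iff.2 fun k hk =>
      sub_ne_zero.2 fun h => Finset.ne_of_mem_erase hk (hG.injective h).symm
  refine nonneg_of_mul_nonneg_left ?_ (sq_pos_of_ne_zero hne)
  rw [hexact]
  exact intervalIntegral.integral_nonneg (by norm_num) fun y hy =>
    mul_nonneg (hw y hy) (sq_nonneg _)

lemma sum_weight (hG : IsGaussRule w Q node weight) (hQ : 0 < Q) :
    ∑ j, weight j = ∫ y in (-1 : ℝ)..1, w y := by
  simpa only [Polynomial.eval_one, mul_one] using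
    hG.exact 1 (by rw [Polynomial.natDegree_one]; omega)

lemma exact_complex (hG : IsGaussRule w Q node weight) (hwi : IntervalIntegrable w volume (-1) 1)
    {p : Polynomial ℂ} (hp : p.natDegree < 2 * Q) :
    ∑ j, (weight j : ℂ) * p.eval (node j : ℂ) = ∫ y in (-1 : ℝ)..1, (w y : ℂ) * p.eval (y : ℂ) := by
  have hmonomial (k : ℕ) (hk : k < 2 * Q) :
      ∑ j, (weight j : ℂ) * (node j : ℂ) ^ k = ∫ y in (-1 : ℝ)..1, (w y : ℂ) * (y : ℂ) ^ k := by
    have h := hG.exact (.X ^ k) (by rwa [Polynomial.natDegree_X_pow])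
    simp only [Polynomial.eval_pow, Polynomial.eval_X] at h
    calc ∑ j, (weight j : ℂ) * (node j : ℂ) ^ k = ((∑ j, weight j * node j ^ k : ℝ) : ℂ) := by
          push_cast
          rfl
      _ = ∫ y in (-1 : ℝ)..1, (w y : ℂ) * (y : ℂ) ^ k := by
          rw [h, ← intervalIntegral.integral_ofReal]
          push_cast
          rfl
  have hint (k : ℕ) : IntervalIntegrable (fun y : ℝ => p.coeff k * ((w y : ℂ) * (y : ℂ) ^ k))
      volume (-1) 1 :=
    IntervalIntegrable.const_mul (IntervalIntegrable.mul_continuousOn ⟨hwi.1.ofReal, hwi.2.ofReal⟩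
      (Complex.continuous_ofReal.pow k).continuousOn) _
  simp only [Polynomial.eval_eq_sum_range' hp, Finset.mul_sum, mul_left_comm _ (p.coeff _)]
  rw [intervalIntegral.integral_finsetSum fun k _ => hint k, Finset.sum_comm]
  refine Finset.sum_congr rfl fun k hk => ?_
  rw [intervalIntegral.integral_const_mul, ← hmonomial k (Finset.mem_range.1 hk), Finset.mul_sum]

lemma norm_integral_sub_sum_le (hG : IsGaussRule w Q node weight) (hQ : 0 < Q)
    (hw : ∀ y ∈ Set.Icc (-1 : ℝ) 1, 0 ≤ w y) (hwi : IntervalIntegrable w volume (-1) 1)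
    {f : ℝ → E} {ε : ℝ}
    (hε : ∀ y ∈ Set.Icc (-1 : ℝ) 1, ‖f y‖ ≤ ε) :
    ‖(∫ y in (-1 : ℝ)..1, (w y : ℂ) • f y) - ∑ j, (weight j : ℂ) • f (node j)‖ ≤
      2 * ε * ∫ y in (-1 : ℝ)..1, w y := by
  have hintegral : ‖∫ y in (-1 : ℝ)..1, (w y : ℂ) • f y‖ ≤ (∫ y in (-1 : ℝ)..1, w y) * ε := by
    rw [← intervalIntegral.integral_mul_const]
    refine intervalIntegral.norm_integral_le_of_norm_le (by norm_num)
      (.of_forall fun y hy => ?_) (hwi.mul_const ε)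
    have hy' := Set.Ioc_subset_Icc_self hy
    rw [norm_smul, Complex.norm_real, Real.norm_of_nonneg (hw y hy')]
    exact mul_le_mul_of_nonneg_left (hε y hy') (hw y hy')
  have hsum : ‖∑ j, (weight j : ℂ) • f (node j)‖ ≤ (∫ y in (-1 : ℝ)..1, w y) * ε := by
    rw [← hG.sum_weight hQ, Finset.sum_mul]
    refine norm_sum_le_of_le _ fun j _ => ?_
    have hj := hG.weight_nonneg hw j
    rw [norm_smul, Complex.norm_real, Real.norm_of_nonneg hj]
    exact mul_le_mul_of_nonneg_left (hε _ (Set.Ioo_subset_Icc_self (hG.mem_Ioo j))) hj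
  linarith [norm_sub_le (∫ y in (-1 : ℝ)..1, (w y : ℂ) • f y) (∑ j, (weight j : ℂ) • f (node j))]

lemma norm_error_le_of_approximation (hG : IsGaussRule w Q node weight) (hQ : 0 < Q)
    (hw : ∀ y ∈ Set.Icc (-1 : ℝ) 1, 0 ≤ w y) (hwi : IntervalIntegrable w volume (-1) 1)
    {f : ℝ → ℂ} (hf : ContinuousOn f (Set.Icc (-1) 1))
    {p : Polynomial ℂ} (hp : p.natDegree < 2 * Q) {ε : ℝ}
    (hε : ∀ y ∈ Set.Icc (-1 : ℝ) 1, ‖f y - p.eval (y : ℂ)‖ ≤ ε) :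
    ‖(∫ y in (-1 : ℝ)..1, (w y : ℂ) * f y) - ∑ j, (weight j : ℂ) * f (node j)‖ ≤
      2 * ε * ∫ y in (-1 : ℝ)..1, w y := by
  have hwC : IntervalIntegrable (fun y => (w y : ℂ)) volume (-1) 1 := ⟨hwi.1.ofReal, hwi.2.ofReal⟩
  have hfi := hwC.mul_continuousOn (g := f) (by rwa [Set.uIcc_of_le (by norm_num)])
  have hpi := hwC.mul_continuousOn (g := fun y => p.eval (y : ℂ))
    (p.continuous.comp Complex.continuous_ofReal).continuousOn
  have hsub := hG.norm_integral_sub_sum_le hQ hw hwi hε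
  simp only [smul_eq_mul, mul_sub, Finset.sum_sub_distrib] at hsub
  rwa [intervalIntegral.integral_sub hfi hpi, hG.exact_complex hwi hp, sub_sub_sub_cancel_right]
    at hsub

lemma norm_error_le_of_bernsteinEllipse (hG : IsGaussRule w Q node weight) (hQ : 0 < Q)
    (hw : ∀ y ∈ Set.Icc (-1 : ℝ) 1, 0 ≤ w y) (hwi : IntervalIntegrable w volume (-1) 1)
    {f : ℂ → ℂ} {ρ M : ℝ} (hρ : 1 < ρ)
    (hf : ∀ u ∈ bernsteinEllipse ρ, DifferentiableAt ℂ f u)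
    (hM : ∀ u ∈ bernsteinEllipse ρ, ‖f u‖ ≤ M) :
    ‖(∫ y in (-1 : ℝ)..1, (w y : ℂ) * f y) - ∑ j, (weight j : ℂ) * f (node j)‖ ≤
      4 * M * (ρ⁻¹ ^ (2 * Q) / (1 - ρ⁻¹)) * ∫ y in (-1 : ℝ)..1, w y := by
  obtain ⟨p, hdeg, hp⟩ := exists_polynomial_approximation hρ hf hM (m := 2 * Q) (by omega)
  have hcont : ContinuousOn (fun y : ℝ => f y) (Set.Icc (-1) 1) := fun y hy =>
    ((hf _ (ofReal_mem_bernsteinEllipse hρ.le hy)).continuousAt.comp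
      Complex.continuous_ofReal.continuousAt).continuousWithinAt
  refine (hG.norm_error_le_of_approximation hQ hw hwi hcont hdeg hp).trans_eq ?_
  ring

/-- The scalar bound is applied to a functional that norms the error. -/
lemma seminorm_error_le_of_bernsteinEllipse (hG : IsGaussRule w Q node weight) (hQ : 0 < Q)
    (hw : ∀ y ∈ Set.Icc (-1 : ℝ) 1, 0 ≤ w y) (hwi : IntervalIntegrable w volume (-1) 1)
    [CompleteSpace E] {N : Seminorm ℂ E}
    (hN : Continuous N) {f : ℂ → E} {ρ M : ℝ} (hρ : 1 < ρ)
    (hf : ∀ u ∈ bernsteinEllipse ρ, DifferentiableAt ℂ f u)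
    (hM : ∀ u ∈ bernsteinEllipse ρ, N (f u) ≤ M) :
    N ((∫ y in (-1 : ℝ)..1, (w y : ℂ) • f y) - ∑ j, (weight j : ℂ) • f (node j)) ≤
      4 * M * (ρ⁻¹ ^ (2 * Q) / (1 - ρ⁻¹)) * ∫ y in (-1 : ℝ)..1, w y := by
  obtain ⟨φ, hφ, hφN⟩ := exists_dual_eq_seminorm hN
    ((∫ y in (-1 : ℝ)..1, (w y : ℂ) • f y) - ∑ j, (weight j : ℂ) • f (node j))
  have hfi : IntervalIntegrable (fun y => (w y : ℂ) • f y) volume (-1) 1 := by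
    refine IntervalIntegrable.smul_continuousOn ⟨hwi.1.ofReal, hwi.2.ofReal⟩ fun y hy => ?_
    rw [Set.uIcc_of_le (by norm_num)] at hy
    exact ((hf _ (ofReal_mem_bernsteinEllipse hρ.le hy)).continuousAt.comp
      Complex.continuous_ofReal.continuousAt).continuousWithinAt
  have hcomm : φ ((∫ y in (-1 : ℝ)..1, (w y : ℂ) • f y) - ∑ j, (weight j : ℂ) • f (node j)) =
      (∫ y in (-1 : ℝ)..1, (w y : ℂ) * φ (f y)) - ∑ j, (weight j : ℂ) * φ (f (node j)) := by
    simp only [map_sub, map_sum, ← φ.intervalIntegral_comp_comm hfi, map_smul, smul_eq_mul]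
  rw [← hφN, hcomm]
  exact hG.norm_error_le_of_bernsteinEllipse (f := fun u => φ (f u)) hQ hw hwi hρ
    (fun u hu => φ.differentiableAt.comp u (hf u hu)) fun u hu => (hφ _).trans (hM u hu)

end IsGaussRule

section JacobiWeight

lemma jacobiWeight_nonneg (y : ℝ) (hy : y ∈ Set.Icc (-1 : ℝ) 1) : 0 ≤ jacobiWeight y :=
  Real.rpow_nonneg (by linarith [hy.1]) _

lemma intervalIntegrable_jacobiWeight : IntervalIntegrable jacobiWeight volume (-1) 1 := by
  have h := (intervalIntegral.intervalIntegrable_rpow' (a := 0) (b := 2) (r := -(1 / 2))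
    (by norm_num)).comp_add_left 1
  rwa [zero_sub, show (2 : ℝ) - 1 = 1 by norm_num] at h

lemma integral_jacobiWeight : ∫ y in (-1 : ℝ)..1, jacobiWeight y = 2 * √2 := by
  simp only [jacobiWeight]
  rw [intervalIntegral.integral_comp_add_left (fun y : ℝ => y ^ (-(1 / 2) : ℝ)) 1,
    integral_rpow (Or.inl (by norm_num)), Real.sqrt_eq_rpow]
  norm_num
  ring

lemma jacobiWeight_mul_sqrt {y : ℝ} (hy : -1 < y) : jacobiWeight y * √(1 + y) = 1 := by
  rw [jacobiWeight, Real.sqrt_eq_rpow, ← Real.rpow_add (by linarith), neg_add_cancel,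
    Real.rpow_zero]

end JacobiWeight

section RungeKutta

variable {s : ℕ} {A : Matrix (Fin (s + 1)) (Fin (s + 1)) ℝ} {b : Fin (s + 1) → ℝ} {z : ℂ}

lemma isUnit_of_isUnit_map_constantCoeff {m R : Type*} [Fintype m] [DecidableEq m] [CommRing R]
    {M : Matrix m m (PowerSeries R)} (hM : IsUnit (M.map (PowerSeries.constantCoeff (R := R)))) :
    IsUnit M := by
  rw [isUnit_iff_isUnit_det] at hM ⊢
  rwa [PowerSeries.isUnit_iff_constantCoeff, RingHom.map_det]

lemma coeff_eq_pow_mul {R : Type*} [CommRing R] {r a : R} {p : PowerSeries R}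
    (hp : PowerSeries.C a = (1 - PowerSeries.C r * PowerSeries.X) * p) (n : ℕ) :
    PowerSeries.coeff n p = r ^ n * a := by
  have hcoeff (k : ℕ) := congrArg (PowerSeries.coeff k) hp
  simp only [sub_mul, one_mul, mul_assoc, map_sub, PowerSeries.coeff_C_mul,
    PowerSeries.coeff_C] at hcoeff
  induction n with
  | zero => simpa using (hcoeff 0).symm
  | succ n ih =>
    have hn := hcoeff (n + 1)
    rw [if_neg n.succ_ne_zero, PowerSeries.coeff_succ_X_mul, ih] at hn
    linear_combination -hn

lemma single_vecMul_complexMatrix (hA : IsUnit A) (hb : b ᵥ* A⁻¹ = Pi.single (Fin.last s) 1) :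
    Pi.single (Fin.last s) 1 ᵥ* complexMatrix A = complexVector b := by
  have hreal : Pi.single (Fin.last s) 1 ᵥ* A = b := by
    rw [← hb, vecMul_vecMul, nonsing_inv_mul _ ((isUnit_iff_isUnit_det _).1 hA), vecMul_one]
  funext j
  simp [complexMatrix, complexVector, ← hreal]

lemma qVector_vecMul (hz : IsUnit (1 - z • complexMatrix A)) :
    qVector A b z ᵥ* (1 - z • complexMatrix A) = complexVector b := by
  rw [qVector, vecMul_vecMul, nonsing_inv_mul _ ((isUnit_iff_isUnit_det _).1 hz), vecMul_one]

lemma stabilityFunction_eq (A : Matrix (Fin (s + 1)) (Fin (s + 1)) ℝ) (b : Fin (s + 1) → ℝ)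
    (z : ℂ) : stabilityFunction A b z = 1 + z * (qVector A b z ⬝ᵥ 1) := by
  rw [stabilityFunction, qVector, dotProduct_mulVec]

/-- The matrix `A + ζ / (1 - ζ) 𝟙 bᵀ` of power series in `ζ`, whose inverse is the symbol. -/
noncomputable def invSymbol (A : Matrix (Fin (s + 1)) (Fin (s + 1)) ℝ) (b : Fin (s + 1) → ℝ) :
    Matrix (Fin (s + 1)) (Fin (s + 1)) (PowerSeries ℂ) :=
  (complexMatrix A).map (fun a => PowerSeries.C a)
    + ((PowerSeries.X : PowerSeries ℂ) * (1 - PowerSeries.X)⁻¹) •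
      (vecMulVec (1 : Fin (s + 1) → ℂ) (complexVector b)).map (fun a => PowerSeries.C a)

lemma invSymbol_apply (i j : Fin (s + 1)) :
    invSymbol A b i j = PowerSeries.C (complexMatrix A i j) +
      PowerSeries.X * (1 - PowerSeries.X)⁻¹ * PowerSeries.C (complexVector b j) := by
  simp [invSymbol]

lemma isUnit_invSymbol (hA : IsUnit A) : IsUnit (invSymbol A b) := by
  have hcoeff : (invSymbol A b).map (PowerSeries.constantCoeff (R := ℂ)) = complexMatrix A := by
    ext i j
    simp [invSymbol_apply]
  refine isUnit_of_isUnit_map_constantCoeff ?_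
  rw [hcoeff]
  exact hA.map (Complex.ofRealHom.mapMatrix (m := Fin (s + 1)))

lemma isUnit_one_sub_smul_invSymbol (hz : IsUnit (1 - z • complexMatrix A)) :
    IsUnit (1 - (PowerSeries.C z : PowerSeries ℂ) • invSymbol A b) := by
  refine isUnit_of_isUnit_map_constantCoeff ?_
  convert hz using 1
  ext i j
  simp [invSymbol_apply, one_apply, apply_ite]

lemma inv_symbol_sub (hA : IsUnit A) (hz : IsUnit (1 - z • complexMatrix A)) :
    (symbol A b - (PowerSeries.C z : PowerSeries ℂ) • 1)⁻¹ =
      invSymbol A b * (1 - (PowerSeries.C z : PowerSeries ℂ) • invSymbol A b)⁻¹ := by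
  have hinv : symbol A b * invSymbol A b = 1 :=
    nonsing_inv_mul _ ((isUnit_iff_isUnit_det _).1 (isUnit_invSymbol hA))
  refine inv_eq_right_inv ?_
  rw [← mul_assoc, sub_mul, hinv, smul_mul_assoc, one_mul, mul_nonsing_inv _
    ((isUnit_iff_isUnit_det _).1 (isUnit_one_sub_smul_invSymbol hz))]

lemma C_qVector_vecMul (hA : IsUnit A) (hb : b ᵥ* A⁻¹ = Pi.single (Fin.last s) 1)
    (hz : IsUnit (1 - z • complexMatrix A)) :
    (fun j => PowerSeries.C (qVector A b z j)) ᵥ*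
        (1 - (PowerSeries.C z : PowerSeries ℂ) • invSymbol A b) =
      (1 - PowerSeries.C (stabilityFunction A b z) * PowerSeries.X : PowerSeries ℂ) •
        ((Pi.single (Fin.last s) 1 : Fin (s + 1) → PowerSeries ℂ) ᵥ* invSymbol A b) := by
  have hX : (1 - PowerSeries.X : PowerSeries ℂ) * (1 - PowerSeries.X)⁻¹ = 1 :=
    PowerSeries.mul_inv_cancel _ (by simp)
  have hq := qVector_vecMul (b := b) hz
  rw [vecMul_sub, vecMul_one, vecMul_smul] at hq ⊢
  funext j
  have hqj := congrArg (PowerSeries.C (R := ℂ)) (congrFun hq j)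
  have hbj := congrFun (single_vecMul_complexMatrix hA hb) j
  rw [single_one_vecMul, row_apply] at hbj
  rw [stabilityFunction_eq, Pi.smul_apply, single_one_vecMul, row_apply]
  simp only [Pi.sub_apply, Pi.smul_apply, vecMul, dotProduct, invSymbol_apply, hbj, smul_eq_mul,
    mul_add, Finset.sum_add_distrib, map_sub, map_mul, map_sum, map_add, map_one, Pi.one_apply,
    mul_one, ← Finset.sum_mul] at hqj ⊢
  linear_combination hqj - PowerSeries.C (complexVector b j) * PowerSeries.X *
    (1 + PowerSeries.C z * ∑ i, PowerSeries.C (qVector A b z i)) * hX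

lemma eVector_eq (hA : IsUnit A) (hb : b ᵥ* A⁻¹ = Pi.single (Fin.last s) 1)
    (hz : IsUnit (1 - z • complexMatrix A)) (n : ℕ) :
    eVector A b n z = stabilityFunction A b z ^ n • qVector A b z := by
  have hq : (fun j => PowerSeries.C (qVector A b z j)) =
      (1 - PowerSeries.C (stabilityFunction A b z) * PowerSeries.X : PowerSeries ℂ) •
        ((Pi.single (Fin.last s) 1 : Fin (s + 1) → PowerSeries ℂ) ᵥ*
          (symbol A b - (PowerSeries.C z : PowerSeries ℂ) • 1)⁻¹) := by
    rw [inv_symbol_sub hA hz, ← vecMul_vecMul, ← smul_vecMul, ← C_qVector_vecMul hA hb hz,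
      vecMul_vecMul, mul_nonsing_inv _
        ((isUnit_iff_isUnit_det _).1 (isUnit_one_sub_smul_invSymbol hz)), vecMul_one]
  funext j
  have hqj := congrFun hq j
  rw [Pi.smul_apply, single_one_vecMul, row_apply, smul_eq_mul] at hqj
  exact coeff_eq_pow_mul hqj n

open scoped Matrix.Norms.Operator in
lemma differentiableAt_vecMul_inv_one_sub_smul {m : Type*} [Fintype m] [DecidableEq m]
    (v : m → ℂ) {M : Matrix m m ℂ} (hz : IsUnit (1 - z • M)) :
    DifferentiableAt ℂ (fun z : ℂ => v ᵥ* (1 - z • M)⁻¹) z := by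
  have hinv : DifferentiableAt ℂ (fun z : ℂ => (1 - z • M)⁻¹) z := by
    simp only [nonsing_inv_eq_ringInverse]
    exact DifferentiableAt.inverse (by fun_prop) hz
  exact (LinearMap.toContinuousLinearMap (vecMulBilin ℂ ℂ v)).differentiableAt.comp z hinv

lemma differentiableAt_qVector (hz : IsUnit (1 - z • complexMatrix A)) :
    DifferentiableAt ℂ (qVector A b) z :=
  differentiableAt_vecMul_inv_one_sub_smul _ hz

lemma differentiableAt_stabilityFunction (hz : IsUnit (1 - z • complexMatrix A)) :
    DifferentiableAt ℂ (stabilityFunction A b) z := by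
  have hq := differentiableAt_pi.1 (differentiableAt_qVector (b := b) hz)
  rw [funext (stabilityFunction_eq A b)]
  simp only [dotProduct, Pi.one_apply, mul_one]
  fun_prop

end RungeKutta

section TransferFunction

/-- The entire function `u ↦ cosh √u`. -/
noncomputable def coshSqrt (u : ℂ) : ℂ := ∑' k : ℕ, u ^ k / ((2 * k).factorial : ℂ)

lemma coshSqrt_sq (w : ℂ) : coshSqrt (w ^ 2) = Complex.cosh w := by
  rw [Complex.cosh_eq_tsum, coshSqrt]
  simp_rw [pow_mul]

lemma differentiable_coshSqrt : Differentiable ℂ coshSqrt := by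
  intro z
  have h : DifferentiableOn ℂ coshSqrt (Metric.ball 0 (‖z‖ + 1)) := by
    refine Complex.differentiableOn_tsum_of_summable_norm
      (u := fun k => (‖z‖ + 1) ^ k / (k.factorial : ℝ)) (Real.summable_pow_div_factorial _)
      (fun k => by fun_prop) Metric.isOpen_ball fun k w hw => ?_
    rw [norm_div, norm_pow, Complex.norm_natCast]
    rw [mem_ball_zero_iff] at hw
    gcongr
    omega
  exact (h z (by simp)).differentiableAt (Metric.isOpen_ball.mem_nhds (by simp))

lemma norm_coshSqrt_le (u : ℂ) : ‖coshSqrt u‖ ≤ Real.exp √‖u‖ := by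
  obtain ⟨w, rfl⟩ := IsAlgClosed.exists_pow_nat_eq u (n := 2) (by norm_num)
  rw [coshSqrt_sq, norm_pow, Real.sqrt_sq (norm_nonneg _), Complex.cosh, norm_div,
    Complex.norm_ofNat]
  have hpos := Complex.norm_exp_le_exp_norm w
  have hneg := Complex.norm_exp_le_exp_norm (-w)
  rw [norm_neg] at hneg
  linarith [norm_add_le (Complex.exp w) (Complex.exp (-w))]

/-- The entire function `λ ↦ √λ G(λ, x)`. -/
noncomputable def regularJump (x : ℝ) (lam : ℂ) : ℂ :=
  -Complex.exp (-(Real.pi / 4 * I)) * coshSqrt (I * x ^ 2 * lam)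

lemma differentiable_regularJump (x : ℝ) : Differentiable ℂ (regularJump x) :=
  (differentiable_coshSqrt.comp (by fun_prop)).const_mul _

lemma norm_regularJump_le (x : ℝ) (lam : ℂ) : ‖regularJump x lam‖ ≤ Real.exp (|x| * √‖lam‖) := by
  have hphase : ‖Complex.exp (-(Real.pi / 4 * I))‖ = 1 := by simp [Complex.norm_exp]
  rw [regularJump, norm_mul, norm_neg, hphase, one_mul]
  refine (norm_coshSqrt_le _).trans_eq ?_
  rw [norm_mul, norm_mul, Complex.norm_I, one_mul, norm_pow, Complex.norm_real, Real.norm_eq_abs,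
    Real.sqrt_mul (by positivity), Real.sqrt_sq (abs_nonneg x)]

lemma jumpG_eq_cosh (lam x : ℝ) :
    jumpG lam x = -(Complex.cosh (|x| * (√lam * Complex.exp (Real.pi / 4 * I))) /
      (√lam * Complex.exp (Real.pi / 4 * I))) := by
  have hupper : Complex.exp (-(I * Real.pi / 4)) * (√lam * Complex.exp (I * Real.pi / 2)) =
      √lam * Complex.exp (Real.pi / 4 * I) := by
    rw [mul_left_comm, ← Complex.exp_add]
    ring_nf
  have hlower : Complex.exp (-(I * Real.pi / 4)) *
      (√lam * Complex.exp (I * (-Real.pi : ℝ) / 2)) = -(√lam * Complex.exp (Real.pi / 4 * I)) := by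
    have hangle : -(I * Real.pi / 4) + I * (-Real.pi : ℝ) / 2 =
        Real.pi / 4 * I - Real.pi * I := by
      push_cast
      ring
    rw [mul_left_comm, ← Complex.exp_add, hangle, Complex.exp_sub, Complex.exp_pi_mul_I]
    ring
  simp only [jumpG, transferK, hupper, hlower, Complex.cosh]
  rw [mul_neg, neg_mul_neg, neg_mul, one_div, one_div, inv_neg, mul_inv]
  ring

lemma sqrt_mul_jumpG {lam : ℝ} (hlam : 0 < lam) (x : ℝ) :
    √lam * jumpG lam x = regularJump x lam := by
  have hphase : Complex.exp (Real.pi / 4 * I) ^ 2 = I := by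
    calc Complex.exp (Real.pi / 4 * I) ^ 2 = Complex.exp (Real.pi / 2 * I) := by
          rw [← Complex.exp_nat_mul]
          ring_nf
      _ = I := Complex.exp_pi_div_two_mul_I
  have hsqrt : (√lam : ℂ) ^ 2 = lam := by exact_mod_cast Real.sq_sqrt hlam.le
  have habs : ((|x| : ℝ) : ℂ) ^ 2 = (x : ℂ) ^ 2 := by exact_mod_cast sq_abs x
  have hne : (√lam : ℂ) ≠ 0 := by exact_mod_cast (Real.sqrt_pos.2 hlam).ne'
  have harg : I * x ^ 2 * lam =
      ((|x| : ℝ) * (√lam * Complex.exp (Real.pi / 4 * I))) ^ 2 := by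
    rw [mul_pow, mul_pow, hphase, hsqrt, habs]
    ring
  rw [regularJump, harg, coshSqrt_sq, jumpG_eq_cosh, Complex.exp_neg]
  field_simp

end TransferFunction

section SmoothExtension

variable {s : ℕ} {A : Matrix (Fin (s + 1)) (Fin (s + 1)) ℝ} {b : Fin (s + 1) → ℝ} {h L₀ : ℝ}

/-- The affine substitution `λ = (1 + z) L₀ / 2` that maps `[-1, 1]` onto `[0, L₀]`. -/
noncomputable def affineSubst (L₀ : ℝ) (z : ℂ) : ℂ := (1 + z) * L₀ / 2

/-- The holomorphic extension of the function `smoothFactor` from `(-1, 1]` to the complex plane,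
in which `√(1 + z) G(λ, x)` is replaced by `√(2 / L₀)` times `regularJump`, and `e_n` by its closed
form `r ^ n q`. -/
noncomputable def smoothExtension (A : Matrix (Fin (s + 1)) (Fin (s + 1)) ℝ)
    (b : Fin (s + 1) → ℝ) (h L₀ x : ℝ) (n : ℕ) (z : ℂ) : Fin (s + 1) → ℂ :=
  (h * L₀ / (4 * Real.pi * I) * √(2 / L₀) * regularJump x (affineSubst L₀ z) *
      stabilityFunction A b (-h * affineSubst L₀ z) ^ n) •
    qVector A b (-h * affineSubst L₀ z)

lemma smoothFactor_eq_smoothExtension (hA : IsUnit A)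
    (hb : b ᵥ* A⁻¹ = Pi.single (Fin.last s) 1) (hL : 0 < L₀) (x : ℝ) (n : ℕ) {y : ℝ} (hy : -1 < y)
    (hz : IsUnit (1 - (-h * affineSubst L₀ y : ℂ) • complexMatrix A)) :
    smoothFactor A b h L₀ x n y = smoothExtension A b h L₀ x n y := by
  have hlam : 0 < (1 + y) * L₀ / 2 := by
    have : 0 < 1 + y := by linarith
    positivity
  have hcast : affineSubst L₀ y = ((1 + y) * L₀ / 2 : ℝ) := by
    push_cast
    rfl
  have hsqrt : √(1 + y) = √(2 / L₀) * √((1 + y) * L₀ / 2) := by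
    rw [← Real.sqrt_mul (by positivity)]
    congr 1
    field_simp
  change (h * L₀ / (4 * Real.pi * I) * √(1 + y) * jumpG ((1 + y) * L₀ / 2) x : ℂ) •
    eVector A b n (-h * affineSubst L₀ y) = _
  rw [smoothExtension, eVector_eq hA hb hz, smul_smul, hcast, ← sqrt_mul_jumpG hlam, hsqrt]
  congr 1
  push_cast
  ring

lemma differentiableAt_smoothExtension {x : ℝ} {n : ℕ} {z : ℂ}
    (hz : IsUnit (1 - (-h * affineSubst L₀ z) • complexMatrix A)) :
    DifferentiableAt ℂ (smoothExtension A b h L₀ x n) z := by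
  have hlam : DifferentiableAt ℂ (affineSubst L₀) z :=
    ((differentiableAt_id.const_add 1).mul_const _).div_const 2
  have hjump := (differentiable_regularJump x _).comp z hlam
  have hr := (differentiableAt_stabilityFunction (b := b) hz).comp z (hlam.const_mul (-h : ℂ))
  have hq := (differentiableAt_qVector (b := b) hz).comp z (hlam.const_mul (-h : ℂ))
  exact ((hjump.const_mul _).mul (hr.pow n)).smul hq

lemma initialIntegral_eq (A : Matrix (Fin (s + 1)) (Fin (s + 1)) ℝ) (b : Fin (s + 1) → ℝ)
    (h L₀ x : ℝ) (n : ℕ) :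
    initialIntegral A b h L₀ x n =
      ∫ y in (-1 : ℝ)..1, (jacobiWeight y : ℂ) • smoothFactor A b h L₀ x n y := by
  have hsubst : (∫ lam in (0 : ℝ)..L₀, jumpG lam x • eVector A b n (-(h : ℂ) * lam)) =
      ((L₀ / 2 : ℝ) : ℂ) • ∫ y in (-1 : ℝ)..1, jumpG (L₀ / 2 + L₀ / 2 * y) x •
        eVector A b n (-(h : ℂ) * ((L₀ / 2 + L₀ / 2 * y : ℝ) : ℂ)) := by
    rw [Complex.coe_smul, intervalIntegral.smul_integral_comp_add_mul
      (fun lam : ℝ => jumpG lam x • eVector A b n (-(h : ℂ) * lam))]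
    ring_nf
  rw [initialIntegral, hsubst, smul_smul, ← intervalIntegral.integral_smul]
  refine intervalIntegral.integral_congr_ae (.of_forall fun y hy => ?_)
  rw [Set.uIoc_of_le (by norm_num)] at hy
  have hw : (jacobiWeight y : ℂ) * (√(1 + y) : ℂ) = 1 := by
    exact_mod_cast jacobiWeight_mul_sqrt hy.1
  have hlam : L₀ / 2 + L₀ / 2 * y = (1 + y) * L₀ / 2 := by ring
  rw [smoothFactor, smul_smul, smul_smul, hlam]
  push_cast
  congr 1
  linear_combination (-(h : ℂ) * L₀ / (4 * Real.pi * I) * jumpG ((1 + y) * L₀ / 2) x) * hw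

lemma quadratureError_eq (hA : IsUnit A) (hb : b ᵥ* A⁻¹ = Pi.single (Fin.last s) 1) (hL : 0 < L₀)
    (x : ℝ) (n : ℕ) {Q : ℕ} {node weight : Fin Q → ℝ} (hnode : ∀ j, -1 < node j)
    (hz : ∀ y : ℝ, -1 < y → IsUnit (1 - (-h * affineSubst L₀ y : ℂ) • complexMatrix A)) :
    quadratureError A b h L₀ x n node weight =
      (∫ y in (-1 : ℝ)..1, (jacobiWeight y : ℂ) • smoothExtension A b h L₀ x n y) -
        ∑ j, (weight j : ℂ) • smoothExtension A b h L₀ x n (node j) := by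
  have hext (y : ℝ) (hy : -1 < y) :=
    smoothFactor_eq_smoothExtension hA hb hL x n hy (hz y hy)
  rw [quadratureError, initialIntegral_eq]
  congr 1
  · refine intervalIntegral.integral_congr_ae (.of_forall fun y hy => ?_)
    rw [Set.uIoc_of_le (by norm_num)] at hy
    rw [hext y hy.1]
  · exact Finset.sum_congr rfl fun j _ => by rw [hext _ (hnode j)]

end SmoothExtension

section Bounds

variable {s : ℕ} {A : Matrix (Fin (s + 1)) (Fin (s + 1)) ℝ} {b : Fin (s + 1) → ℝ}
  {N : Seminorm ℂ (Fin (s + 1) → ℂ)} {ν β Cq h L₀ : ℝ}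

lemma re_neg_mul_affineSubst (h L₀ : ℝ) (z : ℂ) :
    (-h * affineSubst L₀ z).re = -(h * L₀ / 2 * (1 + z.re)) := by
  have hcast : -h * affineSubst L₀ z = ((-(h * L₀ / 2) : ℝ) : ℂ) * (1 + z) := by
    rw [affineSubst]
    push_cast
    ring
  rw [hcast, Complex.re_ofReal_mul, Complex.add_re, Complex.one_re, neg_mul]

lemma re_neg_mul_affineSubst_le (hh : 0 ≤ h) (hL : 0 ≤ L₀) {u : ℂ} {a : ℝ} (hu : ‖u‖ ≤ a) :
    (-h * affineSubst L₀ u).re ≤ h * L₀ / 2 * (a - 1) := by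
  have hre : -a ≤ u.re := (abs_le.1 ((Complex.abs_re_le_norm u).trans hu)).1
  rw [re_neg_mul_affineSubst, ← mul_neg]
  gcongr
  linarith

lemma sqrt_norm_affineSubst_le (hL : 0 ≤ L₀) {u : ℂ} {a : ℝ} (ha : 2 ≤ a) (hu : ‖u‖ ≤ a) :
    √‖affineSubst L₀ u‖ ≤ √(3 * L₀ / 2) * (a - 1) := by
  have hnorm : ‖1 + u‖ ≤ 3 * (a - 1) ^ 2 :=
    calc ‖1 + u‖ ≤ 1 + a := (norm_add_le 1 u).trans (by rw [norm_one]; gcongr)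
      _ ≤ 3 * (a - 1) ^ 2 := by nlinarith
  refine Real.sqrt_le_iff.2 ⟨mul_nonneg (Real.sqrt_nonneg _) (by linarith), ?_⟩
  rw [mul_pow, Real.sq_sqrt (by positivity), affineSubst, norm_div, norm_mul, Complex.norm_real,
    Real.norm_of_nonneg hL, Complex.norm_ofNat]
  calc ‖1 + u‖ * L₀ / 2 ≤ 3 * (a - 1) ^ 2 * L₀ / 2 := by gcongr
    _ = 3 * L₀ / 2 * (a - 1) ^ 2 := by ring

lemma norm_stabilityFunction_le (hν : 0 ≤ ν)
    (hstab : ∀ z : ℂ, z.re ≤ 0 → ‖stabilityFunction A b z‖ ≤ 1)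
    (hr : ∀ z : ℂ, 0 ≤ z.re → z.re ≤ β → ‖stabilityFunction A b z‖ ≤ Real.exp (ν * z.re))
    {z : ℂ} {m : ℝ} (hm : 0 ≤ m) (hmβ : m ≤ β) (hz : z.re ≤ m) :
    ‖stabilityFunction A b z‖ ≤ Real.exp (ν * m) := by
  rcases le_total z.re 0 with hneg | hpos
  · exact (hstab z hneg).trans (Real.one_le_exp (by positivity))
  · exact (hr z hpos (hz.trans hmβ)).trans (by gcongr)

lemma norm_smoothExtension_const (hh : 0 ≤ h) (hL : 0 < L₀) :
    ‖(h * L₀ / (4 * Real.pi * I) * √(2 / L₀) : ℂ)‖ = h * √(2 * L₀) / (4 * Real.pi) := by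
  have hsqrt : L₀ * √(2 / L₀) = √(2 * L₀) := by
    rw [← Real.sqrt_sq hL.le, ← Real.sqrt_mul (by positivity), Real.sqrt_sq hL.le]
    congr 1
    field_simp
  simp only [norm_mul, norm_div, Complex.norm_I, Complex.norm_real, Complex.norm_ofNat, mul_one,
    Real.norm_of_nonneg hh, Real.norm_of_nonneg hL.le, Real.norm_of_nonneg Real.pi_pos.le,
    Real.norm_of_nonneg (Real.sqrt_nonneg _)]
  rw [← hsqrt]
  ring

lemma seminorm_smoothExtension_le (hν : 0 ≤ ν)
    (hstab : ∀ z : ℂ, z.re ≤ 0 → ‖stabilityFunction A b z‖ ≤ 1)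
    (hr : ∀ z : ℂ, 0 ≤ z.re → z.re ≤ β → ‖stabilityFunction A b z‖ ≤ Real.exp (ν * z.re))
    (hq : ∀ z : ℂ, z.re ≤ β → N (qVector A b z) ≤ Cq)
    (hh : 0 ≤ h) (hL : 0 < L₀) (x : ℝ) (n : ℕ) {u : ℂ} {a : ℝ} (ha : 2 ≤ a)
    (haβ : h * L₀ / 2 * (a - 1) ≤ β) (hu : ‖u‖ ≤ a) :
    N (smoothExtension A b h L₀ x n u) ≤
      h * √(2 * L₀) / (4 * Real.pi) * Cq * Real.exp (growth |x| ν (n * h) L₀ * (a - 1)) := by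
  have hre := re_neg_mul_affineSubst_le hh hL.le hu
  have hm : 0 ≤ h * L₀ / 2 * (a - 1) := mul_nonneg (by positivity) (by linarith)
  have hjump : ‖regularJump x (affineSubst L₀ u)‖ ≤
      Real.exp (|x| * (√(3 * L₀ / 2) * (a - 1))) :=
    (norm_regularJump_le x _).trans (by
      gcongr
      exact sqrt_norm_affineSubst_le hL.le ha hu)
  have hpow : ‖stabilityFunction A b (-h * affineSubst L₀ u)‖ ^ n ≤
      Real.exp (ν * (h * L₀ / 2 * (a - 1))) ^ n := by
    gcongr
    exact norm_stabilityFunction_le hν hstab hr hm haβ hre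
  have hexp : Real.exp (growth |x| ν (n * h) L₀ * (a - 1)) =
      Real.exp (|x| * (√(3 * L₀ / 2) * (a - 1))) * Real.exp (ν * (h * L₀ / 2 * (a - 1))) ^ n := by
    rw [← Real.exp_nat_mul, ← Real.exp_add, growth]
    ring_nf
  rw [smoothExtension, map_smul_eq_mul, norm_mul, norm_mul, norm_pow,
    norm_smoothExtension_const hh hL, hexp]
  calc h * √(2 * L₀) / (4 * Real.pi) * ‖regularJump x (affineSubst L₀ u)‖ *
        ‖stabilityFunction A b (-h * affineSubst L₀ u)‖ ^ n *
        N (qVector A b (-h * affineSubst L₀ u))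
      ≤ h * √(2 * L₀) / (4 * Real.pi) * Real.exp (|x| * (√(3 * L₀ / 2) * (a - 1))) *
        Real.exp (ν * (h * L₀ / 2 * (a - 1))) ^ n * Cq := by
          gcongr
          exact hq _ (hre.trans haβ)
    _ = _ := by ring

theorem seminorm_quadratureError_le (hA : IsUnit A)
    (hb : b ᵥ* A⁻¹ = Pi.single (Fin.last s) 1)
    (hν : 0 ≤ ν) (hdef : ∀ z : ℂ, z.re ≤ β → IsUnit (1 - z • complexMatrix A))
    (hstab : ∀ z : ℂ, z.re ≤ 0 → ‖stabilityFunction A b z‖ ≤ 1)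
    (hr : ∀ z : ℂ, 0 ≤ z.re → z.re ≤ β → ‖stabilityFunction A b z‖ ≤ Real.exp (ν * z.re))
    (hq : ∀ z : ℂ, z.re ≤ β → N (qVector A b z) ≤ Cq)
    (hh : 0 ≤ h) (hL : 0 < L₀) (x : ℝ) (n : ℕ) {Q : ℕ} (hQ : 0 < Q) {node weight : Fin Q → ℝ}
    (hG : IsGaussRule jacobiWeight Q node weight) {ρ : ℝ} (hρ : 1 < ρ)
    (hρ2 : 2 ≤ semiMajorAxis ρ) (hρβ : h * L₀ / 2 * (semiMajorAxis ρ - 1) ≤ β) :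
    N (quadratureError A b h L₀ x n node weight) ≤
      Cq * h * (4 * √L₀ / Real.pi) * (ρ / (ρ - 1)) *
        (ρ⁻¹ ^ (2 * Q) * Real.exp (growth |x| ν (n * h) L₀ * (semiMajorAxis ρ - 1))) := by
  have hunit (u : ℂ) (hu : ‖u‖ ≤ semiMajorAxis ρ) :
      IsUnit (1 - (-h * affineSubst L₀ u) • complexMatrix A) :=
    hdef _ ((re_neg_mul_affineSubst_le hh hL.le hu).trans hρβ)
  have hreal (y : ℝ) (hy : -1 < y) :
      IsUnit (1 - (-h * affineSubst L₀ y : ℂ) • complexMatrix A) := by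
    refine hdef _ (le_trans ?_ ((mul_nonneg (by positivity) (by linarith)).trans hρβ))
    rw [re_neg_mul_affineSubst, Complex.ofReal_re]
    have : 0 ≤ 1 + y := by linarith
    exact neg_nonpos.2 (by positivity)
  rw [quadratureError_eq hA hb hL x n (fun j => (hG.mem_Ioo j).1) hreal]
  refine (hG.seminorm_error_le_of_bernsteinEllipse hQ jacobiWeight_nonneg
    intervalIntegrable_jacobiWeight N.convexOn.locallyLipschitz.continuous hρ
    (fun u hu => differentiableAt_smoothExtension (hunit u (norm_le_semiMajorAxis hu)))
    fun u hu => seminorm_smoothExtension_le hν hstab hr hq hh hL x n hρ2 hρβ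
      (norm_le_semiMajorAxis hu)).trans_eq ?_
  have hratio : (1 - ρ⁻¹)⁻¹ = ρ / (ρ - 1) := by
    have : ρ - 1 ≠ 0 := by linarith
    field_simp
  have htwo : √2 * √2 = 2 := Real.mul_self_sqrt zero_le_two
  rw [integral_jacobiWeight, Real.sqrt_mul zero_le_two, div_eq_mul_inv _ (1 - ρ⁻¹), hratio]
  linear_combination (2 * h * √L₀ / Real.pi * Cq *
    Real.exp (growth |x| ν (n * h) L₀ * (semiMajorAxis ρ - 1)) *
      ρ⁻¹ ^ (2 * Q) * (ρ / (ρ - 1))) * htwo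

end Bounds

section Parameters

variable {d ν t L₀ β h ρ : ℝ} {Q : ℕ}

lemma two_le_semiMajorAxis (hρ : 2 + √3 ≤ ρ) : 2 ≤ semiMajorAxis ρ := by
  have h1 : 1 ≤ 2 + √3 := by linarith [Real.sqrt_nonneg 3]
  have hinv : (2 + √3)⁻¹ = 2 - √3 := by
    refine inv_eq_of_mul_eq_one_right ?_
    linear_combination -Real.sq_sqrt (show (0 : ℝ) ≤ 3 by norm_num)
  calc 2 = semiMajorAxis (2 + √3) := by
        rw [semiMajorAxis, hinv]
        ring
    _ ≤ semiMajorAxis ρ := monotoneOn_semiMajorAxis h1 (h1.trans hρ) hρ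

lemma semiMajorAxis_rhoMax (hβ : 0 ≤ β) (hL : 0 ≤ L₀) (hh : 0 ≤ h) :
    semiMajorAxis (rhoMax β L₀ h) = 1 + 2 * β / (L₀ * h) := by
  have hc : 0 ≤ (2 * β / (L₀ * h)) ^ 2 + 4 * β / (L₀ * h) := by positivity
  have hinv : (rhoMax β L₀ h)⁻¹ =
      1 + 2 * β / (L₀ * h) - √((2 * β / (L₀ * h)) ^ 2 + 4 * β / (L₀ * h)) := by
    refine inv_eq_of_mul_eq_one_right ?_
    rw [rhoMax]
    linear_combination -Real.sq_sqrt hc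
  rw [semiMajorAxis, hinv, rhoMax]
  ring

lemma mul_semiMajorAxis_sub_one_le (hβ : 0 ≤ β) (hL : 0 < L₀) (hh : 0 < h) (h1 : 1 ≤ ρ)
    (hρ : ρ ≤ rhoMax β L₀ h) : h * L₀ / 2 * (semiMajorAxis ρ - 1) ≤ β :=
  calc h * L₀ / 2 * (semiMajorAxis ρ - 1)
      ≤ h * L₀ / 2 * (semiMajorAxis (rhoMax β L₀ h) - 1) := by
        gcongr
        exact monotoneOn_semiMajorAxis h1 (h1.trans hρ) hρ
    _ = β := by
        rw [semiMajorAxis_rhoMax hβ hL.le hh.le]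
        field_simp
        ring

lemma growth_mul_rhoOpt_sub_inv (hρ : 1 < rhoOpt d ν t L₀ Q) :
    growth d ν t L₀ * (rhoOpt d ν t L₀ Q - (rhoOpt d ν t L₀ Q)⁻¹) = 4 * Q := by
  have hD : growth d ν t L₀ ≠ 0 := fun hzero => by simp [rhoOpt, hzero] at hρ
  have hinv : (rhoOpt d ν t L₀ Q)⁻¹ =
      √(1 + (2 * Q / growth d ν t L₀) ^ 2) - 2 * Q / growth d ν t L₀ := by
    refine inv_eq_of_mul_eq_one_right ?_
    rw [rhoOpt]
    linear_combination Real.sq_sqrt (show 0 ≤ 1 + (2 * Q / growth d ν t L₀) ^ 2 by positivity)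
  rw [hinv, rhoOpt]
  field_simp
  ring

lemma inv_pow_mul_exp_le {D : ℝ} (hQ : 0 < Q) (hρ : 1 < ρ) (hD : D * (ρ - ρ⁻¹) = 4 * Q) :
    ρ⁻¹ ^ (2 * Q) * Real.exp (D * (semiMajorAxis ρ - 1)) ≤
      (Real.exp 1 * D / (4 * Q)) ^ (2 * Q) := by
  have hinv : ρ⁻¹ < 1 := inv_lt_one_of_one_lt₀ hρ
  have hpos : (0 : ℝ) < 4 * Q := by positivity
  have hD0 : 0 < D := pos_of_mul_pos_left (hD ▸ hpos) (by linarith)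
  have hle : ρ⁻¹ ≤ D / (4 * Q) := by
    rw [le_div_iff₀ hpos, ← hD, inv_mul_le_iff₀ (by positivity), mul_comm ρ]
    gcongr
    exact sub_le_self _ (by positivity)
  have hexp : Real.exp (D * (semiMajorAxis ρ - 1)) ≤ Real.exp 1 ^ (2 * Q) := by
    rw [← Real.exp_nat_mul, mul_one, Nat.cast_mul, Nat.cast_ofNat]
    refine Real.exp_le_exp.2 ?_
    calc D * (semiMajorAxis ρ - 1) ≤ D * ((ρ - ρ⁻¹) / 2) := by
          gcongr
          rw [semiMajorAxis]
          linarith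
      _ = 2 * Q := by linarith
  calc ρ⁻¹ ^ (2 * Q) * Real.exp (D * (semiMajorAxis ρ - 1))
      ≤ (D / (4 * Q)) ^ (2 * Q) * Real.exp 1 ^ (2 * Q) := by gcongr
    _ = (Real.exp 1 * D / (4 * Q)) ^ (2 * Q) := by
        rw [← mul_pow]
        congr 1
        ring

lemma growth_mul_two_mul_div (hL : 0 < L₀) :
    growth d ν t L₀ * (2 * β / (L₀ * h)) = β / h * (d * √(6 / L₀) + ν * t) := by
  have hsqrt : √(6 / L₀) = √(3 * L₀ / 2) * (2 / L₀) := by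
    rw [← Real.sqrt_sq (show 0 ≤ 2 / L₀ by positivity), ← Real.sqrt_mul (by positivity)]
    congr 1
    field_simp
    norm_num
  rw [growth, hsqrt]
  field_simp

end Parameters

end SchrodingerCQ

open SchrodingerCQ in
theorem theorem4p4_general {s : ℕ} (A : Matrix (Fin (s + 1)) (Fin (s + 1)) ℝ)
    (b : Fin (s + 1) → ℝ) (hA : IsUnit A) (hb : b ᵥ* A⁻¹ = Pi.single (Fin.last s) 1)
    (hstab : ∀ z : ℂ, z.re ≤ 0 → ‖stabilityFunction A b z‖ ≤ 1)
    (N : Seminorm ℂ (Fin (s + 1) → ℂ)) {ν β Cq : ℝ} (hν : 0 ≤ ν) (hβ : 0 ≤ β)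
    (hdef : ∀ z : ℂ, z.re ≤ β → IsUnit (1 - z • complexMatrix A))
    (hr : ∀ z : ℂ, 0 ≤ z.re → z.re ≤ β → ‖stabilityFunction A b z‖ ≤ Real.exp (ν * z.re))
    (hq : ∀ z : ℂ, z.re ≤ β → N (qVector A b z) ≤ Cq)
    {h L₀ : ℝ} (hh : 0 < h) (hL : 0 < L₀) (x : ℝ) (n : ℕ) {Q : ℕ} (hQ : 0 < Q)
    {node weight : Fin Q → ℝ} (hG : IsGaussRule jacobiWeight Q node weight)
    {ρmax ρopt : ℝ} (hρmax : ρmax = rhoMax β L₀ h) (hρopt : ρopt = rhoOpt |x| ν (n * h) L₀ Q) :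
    (ρopt ∈ Set.Icc (2 + √3) ρmax →
      N (quadratureError A b h L₀ x n node weight) ≤
        Cq * h * (4 * √L₀ / Real.pi) * (ρopt / (ρopt - 1)) *
          (Real.exp 1 * growth |x| ν (n * h) L₀ / (4 * Q)) ^ (2 * Q)) ∧
    (2 + √3 ≤ ρmax →
      N (quadratureError A b h L₀ x n node weight) ≤
        Cq * h * (4 * √L₀ / Real.pi) * (ρmax ^ (-2 * (Q : ℤ) + 1) / (ρmax - 1)) *
          Real.exp (β / h * (|x| * √(6 / L₀) + ν * (n * h)))) := by
  subst hρmax hρopt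
  have one_lt {ρ : ℝ} (hρ : 2 + √3 ≤ ρ) : 1 < ρ := by linarith [Real.sqrt_nonneg 3]
  have hbound {ρ : ℝ} (hρ : 2 + √3 ≤ ρ) (hmax : ρ ≤ rhoMax β L₀ h) :=
    seminorm_quadratureError_le hA hb hν hdef hstab hr hq hh.le hL x n hQ hG (one_lt hρ)
      (two_le_semiMajorAxis hρ) (mul_semiMajorAxis_sub_one_le hβ hL hh (one_lt hρ).le hmax)
  refine ⟨fun hopt => (hbound hopt.1 hopt.2).trans ?_, fun hmax => (hbound hmax le_rfl).trans_eq ?_⟩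
  · have hCq : 0 ≤ Cq := (apply_nonneg N _).trans (hq 0 hβ)
    have h1 := one_lt hopt.1
    refine mul_le_mul_of_nonneg_left
      (inv_pow_mul_exp_le hQ h1 (growth_mul_rhoOpt_sub_inv h1)) ?_
    have : 0 < rhoOpt |x| ν (n * h) L₀ Q - 1 := by linarith
    positivity
  · have h0 : rhoMax β L₀ h ≠ 0 := by linarith [one_lt hmax]
    have hpow : rhoMax β L₀ h ^ (-2 * (Q : ℤ) + 1) =
        (rhoMax β L₀ h)⁻¹ ^ (2 * Q) * rhoMax β L₀ h := by
      rw [zpow_add_one₀ h0, neg_mul, _root_.zpow_neg, inv_pow]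
      norm_cast
    rw [semiMajorAxis_rhoMax hβ hL.le hh.le, add_sub_cancel_left, growth_mul_two_mul_div hL, hpow]
    ring

theorem theorem4p4 {s : ℕ} (A : Matrix (Fin (s + 1)) (Fin (s + 1)) ℝ) (b : Fin (s + 1) → ℝ)
    (hRK : SchrodingerCQ.RungeKuttaAssumption A b)
    (N : Seminorm ℂ (Fin (s + 1) → ℂ)) (hN : ∀ v, N v = 0 → v = 0)
    (ν β Cq : ℝ) (hconst : SchrodingerCQ.IsBoundConstants A b N ν β Cq)
    (h L₀ : ℝ) (hh : 0 < h) (hL : 0 < L₀) (x : ℝ) (n Q : ℕ) (hQ : 1 ≤ Q)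
    (node weight : Fin Q → ℝ)
    (hG : SchrodingerCQ.IsGaussRule SchrodingerCQ.jacobiWeight Q node weight)
    (d t ρmax ρopt : ℝ) (hd : d = |x|) (ht : t = n * h)
    (hρmax : ρmax = SchrodingerCQ.rhoMax β L₀ h)
    (hρopt : ρopt = SchrodingerCQ.rhoOpt d ν t L₀ Q) :
    (ρopt ∈ Set.Ioo (2 + Real.sqrt 3) ρmax →
      N (SchrodingerCQ.quadratureError A b h L₀ x n node weight) ≤
        Cq * h * (4 * Real.sqrt L₀ / Real.pi) * (ρopt / (ρopt - 1)) *
          (Real.exp 1 * (d * Real.sqrt (3 * L₀ / 2) + ν * t * L₀ / 2) / (4 * Q)) ^ (2 * Q)) ∧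
    (ρopt ∉ Set.Ioo (2 + Real.sqrt 3) ρmax → 2 + Real.sqrt 3 ≤ ρmax →
      N (SchrodingerCQ.quadratureError A b h L₀ x n node weight) ≤
        Cq * h * (4 * Real.sqrt L₀ / Real.pi) *
          (ρmax ^ (-2 * (Q : ℤ) + 1) / (ρmax - 1)) *
          Real.exp (β / h * (d * Real.sqrt (6 / L₀) + ν * t))) := by

  subst hd ht
  exact (theorem4p4_general A b hRK.invertible hRK.stifflyAccurate hRK.aStable N
    (zero_le_one.trans hconst.one_lt_nu.le) hconst.beta_pos.le hconst.defined hconst.r_bound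
    hconst.q_bound hh hL x n hQ hG hρmax hρopt).imp
    (fun hopt hρ => hopt (Set.Ioo_subset_Icc_self hρ)) fun hmax _ => hmax
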